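/- Let $q=2^m$ and $\sigma=2^k$ with $1\le k<m$, let $d=\gcd(k,m)$, and let $a,b,c\in\mathbb F_q$ with $a\neq 0$. Define $F=(F_1,F_2,F_3)\colon\mathbb F_q^3\to\mathbb F_q^3$ by \begin{align*} F_1(x,y,z)&=x^{\sigma+1}+ay^{\sigma}z+bx^{\sigma}y+cx^{\sigma}z,\\ F_2(x,y,z)&=ay^{\sigma+1}+z^{\sigma}x+bz^{\sigma}y+cx^{\sigma}y,\\ F_3(x,y,z)&=z^{\sigma+1}+x^{\sigma}y. \end{align*} This map is $\sigma$-semiquadratic, i.e. for each $i$ there is a matrix $C^{(i)}\in M_3(\mathbb F_q)$ with $F_i(x,y,z)=(x,y,z)\,C^{(i)}\,(x^\sigma,y^\sigma,z^\sigma)^T$. If the equation $$a x^{\sigma^2+\sigma+1}+b x^{\sigma+1}+c x+1=0$$ has no solution $x\in\mathbb F_q$, then the differential uniformity of $F$, $$\Delta_F=\max\{\#\{w\in\mathbb F_q^3 : F(w+u)-F(w)=v\} : u,v\in\mathbb F_q^3,\ u\neq 0\},$$ equals $2^d$. In particular, if $d=1$, then $F$ is almost perfect nonlinear (APN), i.e.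 $\Delta_F=2$. -/

import Mathlib

/-- Entry `(u, v)` of the difference distribution table of `F`:
the number of `x` such that `F (x + u) - F x = v`. -/
noncomputable def ddt {G : Type*} [AddCommGroup G] (F : G → G) (u v : G) : ℕ :=
  {x : G | F (x + u) - F x = v}.ncard

/-- The differential uniformity of `F`: the largest entry `ddt F u v` with `u ≠ 0`.
On a finite nontrivial group it is an honest maximum, see
`isGreatest_differentialUniformity`. -/
noncomputable def differentialUniformity {G : Type*} [AddCommGroup G] (F : G → G) : ℕ :=
  sSup {n : ℕ | ∃ u v : G, u ≠ 0 ∧ ddt F u v = n}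

theorem isGreatest_differentialUniformity {G : Type*} [AddCommGroup G] [Finite G]
    [Nontrivial G] (F : G → G) :
    IsGreatest {n : ℕ | ∃ u v : G, u ≠ 0 ∧ ddt F u v = n} (differentialUniformity F) := by
  have hne : {n : ℕ | ∃ u v : G, u ≠ 0 ∧ ddt F u v = n}.Nonempty := by
    obtain ⟨u, hu⟩ := exists_ne (0 : G)
    exact ⟨_, u, 0, hu, rfl⟩
  have hb : BddAbove {n : ℕ | ∃ u v : G, u ≠ 0 ∧ ddt F u v = n} := by
    refine ⟨Nat.card G, ?_⟩
    rintro n ⟨u, v, -, rfl⟩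
    exact Set.ncard_le_card _
  exact ⟨Nat.sSup_mem hne hb, fun n hn => le_csSup hb hn⟩

/-- Almost perfect nonlinear functions. The notion is meant for functions on a finite vector
space over the field with two elements, where `2` is the least possible value. -/
def IsAPN {G : Type*} [AddCommGroup G] (F : G → G) : Prop :=
  differentialUniformity F = 2

/-- `H` is a `σ`-semiquadratic map on `K ^ ℓ`: every component has the form
`(y₁, …, y_ℓ) C (y₁ ^ σ, …, y_ℓ ^ σ)ᵀ` for a matrix `C` over `K`. -/
def IsSemiquadratic {K : Type*} [Field K] {ℓ : ℕ} (σ : ℕ)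
    (H : (Fin ℓ → K) → (Fin ℓ → K)) : Prop :=
  ∀ i : Fin ℓ, ∃ C : Matrix (Fin ℓ) (Fin ℓ) K, ∀ y : Fin ℓ → K,
    H y i = dotProduct y (C.mulVec (fun j => y j ^ σ))

/-- The map `F = (F₁, F₂, F₃)` on `K ^ 3` with coefficients `a, b, c`; the coordinates of the
argument are `x = w 0`, `y = w 1`, `z = w 2`. -/
def trivariateMap {K : Type*} [Field K] (σ : ℕ) (a b c : K) (w : Fin 3 → K) : Fin 3 → K :=
  let x := w 0
  let y := w 1
  let z := w 2
  ![x ^ (σ + 1) + a * y ^ σ * z + b * x ^ σ * y + c * x ^ σ * z,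
    a * y ^ (σ + 1) + z ^ σ * x + b * z ^ σ * y + c * x ^ σ * y,
    z ^ (σ + 1) + x ^ σ * y]

/-!
Write `F w = f (w ^ σ, w)` with `f` bilinear. The fibres of `w ↦ F (w + u) - F w` are empty or
translates of the solution space of `f (δ ^ σ, u) + f (u ^ σ, δ) = 0`, and this space contains
`t • u` whenever `t ^ σ = t`, which gives `2 ^ gcd k m` solutions.

There are no others. The vector `V = f (u ^ σ, u)` is nonzero, since a zero of `F` would produce a
root of the projective polynomial. In characteristic two, two linear forms in `V` are alternating in
`f`: `V` yields a vector `α` orthogonal to `u` and `δ`, and a vector `β` orthogonal to `u ^ σ` and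
`δ ^ σ`. If `u` and `δ` were independent, then `α ^ σ` and `β` would be proportional, and
eliminating coordinates gives a root `μ` of the adjoint polynomial. It makes a `σ`-linear operator
take values in the range of `t ↦ t ^ σ - t`, so this operator has a nonzero kernel element `g`, and
`μ * g ^ σ / g` is a root of the projective polynomial.
-/

open Matrix QuadraticMap

section DifferenceDistribution

variable {G : Type*} [AddCommGroup G] {F : G → G}

theorem ddt_sub_eq_ncard_polar
    (hF : ∀ x x' y, polar F (x + x') y = polar F x y + polar F x' y) (u w₀ : G) :
    ddt F u (F (w₀ + u) - F w₀) = {δ | polar F δ u = 0}.ncard := by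
  rw [ddt, ← Set.ncard_image_of_injective {δ | polar F δ u = 0} (add_right_injective w₀)]
  congr 1
  ext w
  have hpolar : polar F (w - w₀) u = F (w + u) - F w - (F (w₀ + u) - F w₀) := by
    have h := hF (w - w₀) w₀ u
    rw [sub_add_cancel] at h
    rw [← sub_eq_iff_eq_add.mpr h]
    simp only [polar]
    abel
  simp [hpolar, Set.image_add_left, neg_add_eq_sub, sub_eq_zero]

theorem differentialUniformity_eq_of_ncard_polar [Finite G] [Nontrivial G]
    (hF : ∀ x x' y, polar F (x + x') y = polar F x y + polar F x' y) {N : ℕ}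
    (hN : ∀ u ≠ 0, {δ | polar F δ u = 0}.ncard = N) : differentialUniformity F = N := by
  obtain ⟨⟨u, v, hu, huv⟩, hmax⟩ := isGreatest_differentialUniformity F
  refine le_antisymm ?_ (hmax ⟨u, _, hu, (ddt_sub_eq_ncard_polar hF u 0).trans (hN u hu)⟩)
  rw [← huv]
  rcases Set.eq_empty_or_nonempty {w | F (w + u) - F w = v} with hempty | ⟨w₀, rfl⟩
  · simp [ddt, hempty]
  · exact ((ddt_sub_eq_ncard_polar hF u w₀).trans (hN u hu)).le

end DifferenceDistribution

section SemiquadraticPolar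

variable {R V W : Type*} [CommRing R] [AddCommGroup V] [AddCommGroup W] [Module R V] [Module R W]

theorem polar_bilinear_comp (f : V →ₗ[R] V →ₗ[R] W) (g : V →+ V) (x y : V) :
    polar (fun w => f (g w) w) x y = f (g x) y + f (g y) x := by
  simp only [polar, map_add, LinearMap.add_apply]
  abel

theorem polar_bilinear_comp_add_left (f : V →ₗ[R] V →ₗ[R] W) (g : V →+ V) (x x' y : V) :
    polar (fun w => f (g w) w) (x + x') y =
      polar (fun w => f (g w) w) x y + polar (fun w => f (g w) w) x' y := by
  simp only [polar_bilinear_comp, map_add, LinearMap.add_apply]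
  abel

end SemiquadraticPolar

section FiniteField

variable {K : Type*} [Field K] [Finite K]

theorem ncard_pow_succ_eq_self (n : ℕ) :
    {x : K | x ^ (n + 1) = x}.ncard = Nat.gcd (Nat.card K - 1) n + 1 := by
  have hset : {x : K | x ^ (n + 1) = x} =
      insert 0 (Units.val '' ((powMonoidHom n : Kˣ →* Kˣ).ker : Set Kˣ)) := by
    ext x
    rcases eq_or_ne x 0 with rfl | hx
    · simp
    · lift x to Kˣ using hx.isUnit
      simp [pow_succ, ← Units.val_pow_eq_pow_val, Units.val_inj]
  rw [hset, Set.ncard_insert_of_notMem (by simp),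
    Set.ncard_image_of_injective _ Units.val_injective, ← Nat.card_coe_set_eq]
  exact congrArg (· + 1) ((IsCyclic.card_powMonoidHom_ker Kˣ n).trans (by rw [Nat.card_units]))

theorem ncard_pow_pow_eq_self {p m : ℕ} (hp : p ≠ 0) (hK : Nat.card K = p ^ m) (k : ℕ) :
    {x : K | x ^ p ^ k = x}.ncard = p ^ Nat.gcd k m := by
  have hpos (n : ℕ) : 1 ≤ p ^ n := Nat.one_le_iff_ne_zero.mpr (pow_ne_zero n hp)
  rw [← Nat.sub_add_cancel (hpos k), ncard_pow_succ_eq_self, hK, Nat.pow_sub_one_gcd_pow_sub_one,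
    Nat.gcd_comm, Nat.sub_add_cancel (hpos _)]

theorem exists_ne_zero_sum_iterate_eq_zero (φ : K →+* K) {n : ℕ} (c : Fin (n + 1) → K)
    (hc : ∑ i : Fin (n + 1), φ^[n - i] (c i) = 0) : ∃ f ≠ 0, ∑ i, c i * φ^[i] f = 0 := by
  -- The operator `L` maps into `S`, the range of `φ - 1`, which is proper because `φ 1 = 1`.
  let S : AddSubgroup K := (φ.toAddMonoidHom - AddMonoidHom.id K).range
  have iterate_sub_mem (j : ℕ) (y : K) : φ^[j] y - y ∈ S := by
    induction j with
    | zero => simp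
    | succ j ih =>
      rw [Function.iterate_succ_apply', ← sub_add_sub_cancel _ (φ^[j] y)]
      exact S.add_mem ⟨φ^[j] y, rfl⟩ ih
  let L : K →+ K := ∑ i, (AddMonoidHom.mulLeft (c i)).comp (φ ^ (i : ℕ)).toAddMonoidHom
  have hL (f : K) : L f = ∑ i, c i * φ^[i] f := by simp [L]
  have hLS (f : K) : L f ∈ S := by
    have hsum : ∑ i : Fin (n + 1), φ^[n - i] (c i * φ^[i] f) = 0 := by
      calc ∑ i : Fin (n + 1), φ^[n - i] (c i * φ^[i] f)
        _ = (∑ i : Fin (n + 1), φ^[n - i] (c i)) * φ^[n] f := by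
            rw [Finset.sum_mul]
            refine Finset.sum_congr rfl fun i _ => ?_
            rw [iterate_map_mul, ← Function.iterate_add_apply, Nat.sub_add_cancel i.is_le]
        _ = 0 := by rw [hc, zero_mul]
    rw [hL, ← neg_mem_iff, ← zero_sub, ← hsum, ← Finset.sum_sub_distrib]
    exact sum_mem fun i _ => iterate_sub_mem _ _
  have hS : ¬ Function.Surjective (φ.toAddMonoidHom - AddMonoidHom.id K) := fun h =>
    one_ne_zero (α := K) (Finite.injective_iff_surjective.mpr h (by simp))
  have hinj : ¬ Function.Injective L := fun h => hS fun y => by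
    obtain ⟨f, rfl⟩ := Finite.surjective_of_injective h y
    exact hLS f
  rw [injective_iff_map_eq_zero] at hinj
  push Not at hinj
  obtain ⟨f, hf, hf0⟩ := hinj
  exact ⟨f, hf0, by rw [← hL, hf]⟩

end FiniteField

section CrossProduct

variable {K : Type*} [Field K]

theorem map_comp_crossProduct {R S : Type*} [CommRing R] [CommRing S] (φ : R →+* S)
    (x y : Fin 3 → R) : φ ∘ (x ⨯₃ y) = (φ ∘ x) ⨯₃ (φ ∘ y) := by
  ext i
  fin_cases i <;> simp [cross_apply]

theorem exists_smul_eq_of_crossProduct_eq_zero {x y : Fin 3 → K} (hx : x ≠ 0)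
    (h : x ⨯₃ y = 0) : ∃ t : K, t • x = y := by
  have hdep := crossProduct_ne_zero_iff_linearIndependent.not.mp (not_not.mpr h)
  simpa [LinearIndependent.pair_iff' hx] using hdep

theorem crossProduct_eq_zero_of_dotProduct_eq_zero {α β x y : Fin 3 → K} (hxy : x ⨯₃ y ≠ 0)
    (hαx : α ⬝ᵥ x = 0) (hαy : α ⬝ᵥ y = 0) (hβx : β ⬝ᵥ x = 0) (hβy : β ⬝ᵥ y = 0) :
    α ⨯₃ β = 0 := by
  by_contra hαβ
  obtain ⟨s, rfl⟩ := exists_smul_eq_of_crossProduct_eq_zero hαβ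
    (show α ⨯₃ β ⨯₃ x = 0 by simp [cross_cross_eq_smul_sub_smul, hαx, hβx])
  obtain ⟨t, rfl⟩ := exists_smul_eq_of_crossProduct_eq_zero hαβ
    (show α ⨯₃ β ⨯₃ y = 0 by simp [cross_cross_eq_smul_sub_smul, hαy, hβy])
  simp at hxy

end CrossProduct

theorem isSemiquadratic_of_bilinear {K : Type*} [Field K] {ℓ : ℕ} (σ : ℕ)
    (f : (Fin ℓ → K) →ₗ[K] (Fin ℓ → K) →ₗ[K] (Fin ℓ → K)) :
    IsSemiquadratic σ fun w => f (w ^ σ) w := fun i => by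
  refine ⟨LinearMap.toMatrix₂' K (f.flip.compr₂ (LinearMap.proj i)), fun y => ?_⟩
  change _ = dotProduct y (Matrix.mulVec _ (y ^ σ))
  rw [← Matrix.toLinearMap₂'_apply', Matrix.toLinearMap₂'_toMatrix']
  simp

section Trivariate

section CommRing

variable {R : Type*} [CommRing R]

/-- The projective polynomial `a X ^ (σ² + σ + 1) + b X ^ (σ + 1) + c X + 1` evaluated at `x`,
with an arbitrary ring endomorphism `φ` in place of the `σ`-th power map. -/
def projectivePoly (φ : R →+* R) (a b c x : R) : R :=
  a * (φ (φ x) * φ x * x) + b * (φ x * x) + c * x + 1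

/-- The bilinear map which gives `trivariateMap` on the pairs `(w ^ σ, w)`. -/
def trivariateForm (a b c : R) : (Fin 3 → R) →ₗ[R] (Fin 3 → R) →ₗ[R] (Fin 3 → R) :=
  LinearMap.mk₂ R
    (fun v w => ![v 0 * w 0 + a * v 1 * w 2 + b * v 0 * w 1 + c * v 0 * w 2,
      a * v 1 * w 1 + v 2 * w 0 + b * v 2 * w 1 + c * v 0 * w 1,
      v 2 * w 2 + v 0 * w 1])
    (fun v v' w => by ext i; fin_cases i <;> dsimp <;> ring)
    (fun s v w => by ext i; fin_cases i <;> dsimp <;> ring)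
    (fun v w w' => by ext i; fin_cases i <;> dsimp <;> ring)
    (fun s v w => by ext i; fin_cases i <;> dsimp <;> ring)

/-- A normal vector, built from a value `trivariateForm a b c v w`, of a plane through the second
argument `w` (in characteristic two). -/
def argumentNormal (b : R) : (Fin 3 → R) →ₗ[R] (Fin 3 → R) where
  toFun V := ![V 2, V 0 + b * V 2, V 1]
  map_add' V V' := by ext i; fin_cases i <;> dsimp; ring
  map_smul' s V := by ext i; fin_cases i <;> dsimp; ring

/-- A normal vector, built from a value `trivariateForm a b c v w`, of a plane through the first
argument `v` (in characteristic two), which is the conjugate `w ^ σ` for `trivariateMap`. -/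
def conjugateNormal (a c : R) : (Fin 3 → R) →ₗ[R] (Fin 3 → R) where
  toFun V := ![V 1 + c * V 2, a * V 2, V 0]
  map_add' V V' := by ext i; fin_cases i <;> dsimp <;> ring
  map_smul' s V := by ext i; fin_cases i <;> dsimp <;> ring

theorem trivariateForm_apply (a b c : R) (v w : Fin 3 → R) :
    trivariateForm a b c v w =
      ![v 0 * w 0 + a * v 1 * w 2 + b * v 0 * w 1 + c * v 0 * w 2,
        a * v 1 * w 1 + v 2 * w 0 + b * v 2 * w 1 + c * v 0 * w 1,
        v 2 * w 2 + v 0 * w 1] := rfl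

theorem argumentNormal_apply (b : R) (V : Fin 3 → R) :
    argumentNormal b V = ![V 2, V 0 + b * V 2, V 1] := rfl

theorem conjugateNormal_apply (a c : R) (V : Fin 3 → R) :
    conjugateNormal a c V = ![V 1 + c * V 2, a * V 2, V 0] := rfl

variable [CharP R 2] {a b c : R}

theorem argumentNormal_trivariateForm_dotProduct_self (v w : Fin 3 → R) :
    argumentNormal b (trivariateForm a b c v w) ⬝ᵥ w = 0 := by
  simp only [argumentNormal_apply, trivariateForm_apply, vec3_dotProduct, cons_val]
  linear_combination (v 0 * w 0 * w 1 + v 2 * w 0 * w 2 + a * v 1 * w 1 * w 2 + b * v 0 * w 1 ^ 2 +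
    c * v 0 * w 1 * w 2 + b * v 2 * w 1 * w 2) * CharTwo.two_eq_zero (R := R)

theorem conjugateNormal_trivariateForm_dotProduct_self (v w : Fin 3 → R) :
    conjugateNormal a c (trivariateForm a b c v w) ⬝ᵥ v = 0 := by
  simp only [conjugateNormal_apply, trivariateForm_apply, vec3_dotProduct, cons_val]
  linear_combination (a * v 0 * v 1 * w 1 + v 0 * v 2 * w 0 + b * v 0 * v 2 * w 1 +
    c * v 0 ^ 2 * w 1 + c * v 0 * v 2 * w 2 + a * v 1 * v 2 * w 2) * CharTwo.two_eq_zero (R := R)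

theorem argumentNormal_trivariateForm_dotProduct_comm (v w w' : Fin 3 → R) :
    argumentNormal b (trivariateForm a b c v w) ⬝ᵥ w' =
      argumentNormal b (trivariateForm a b c v w') ⬝ᵥ w := by
  have h := argumentNormal_trivariateForm_dotProduct_self (a := a) (b := b) (c := c) v (w + w')
  simp only [map_add, add_dotProduct, dotProduct_add,
    argumentNormal_trivariateForm_dotProduct_self, zero_add, add_zero] at h
  exact (CharTwo.add_eq_zero.mp h).symm

theorem conjugateNormal_trivariateForm_dotProduct_comm (v v' w : Fin 3 → R) :
    conjugateNormal a c (trivariateForm a b c v w) ⬝ᵥ v' =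
      conjugateNormal a c (trivariateForm a b c v' w) ⬝ᵥ v := by
  have h := conjugateNormal_trivariateForm_dotProduct_self (a := a) (b := b) (c := c) (v + v') w
  simp only [map_add, LinearMap.add_apply, add_dotProduct, dotProduct_add,
    conjugateNormal_trivariateForm_dotProduct_self, zero_add, add_zero] at h
  exact (CharTwo.add_eq_zero.mp h).symm

end CommRing

variable {K : Type*} [Field K] {φ : K →+* K} {a b c : K}

theorem trivariateMap_eq_trivariateForm (σ : ℕ) :
    trivariateMap σ a b c = fun w => trivariateForm a b c (w ^ σ) w := by
  ext w i
  fin_cases i <;> dsimp [trivariateMap, trivariateForm_apply] <;> ring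

theorem conjugateNormal_eq_zero_iff (ha : a ≠ 0) {v : Fin 3 → K} :
    conjugateNormal a c v = 0 ↔ v = 0 := by
  refine ⟨fun h => ?_, fun h => by rw [h, map_zero]⟩
  have hv0 : v 0 = 0 := congrFun h 2
  have hv2 : v 2 = 0 := (mul_eq_zero_iff_left ha).mp (congrFun h 1)
  have hv1 : v 1 + c * v 2 = 0 := congrFun h 0
  rw [hv2, mul_zero, add_zero] at hv1
  ext i
  fin_cases i <;> assumption

theorem exists_projectivePoly_eq_zero_of_adjoint [Finite K] {μ : K}
    (hμ : a * (φ (φ μ) * φ μ * μ) + φ b * (φ (φ μ) * φ μ) + φ (φ c) * φ (φ μ) + 1 = 0) :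
    ∃ x, projectivePoly φ a b c x = 0 := by
  -- The coefficients are chosen so that `x = μ * φ f / f` solves the projective equation.
  obtain ⟨f, hf0, hsum⟩ := exists_ne_zero_sum_iterate_eq_zero φ
    ![1, c * μ, b * (φ μ * μ), a * (φ (φ μ) * φ μ * μ)] (by
      calc _ = 1 + φ (φ c) * φ (φ μ) + φ b * (φ (φ μ) * φ μ) + a * (φ (φ μ) * φ μ * μ) := by
            simp [Fin.sum_univ_four]
        _ = 0 := by linear_combination hμ)
  have hf : f + c * μ * φ f + b * (φ μ * μ) * φ (φ f) +
      a * (φ (φ μ) * φ μ * μ) * φ (φ (φ f)) = 0 := by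
    simpa [Fin.sum_univ_four] using hsum
  refine ⟨μ * φ f / f, ?_⟩
  have hφf : φ f ≠ 0 := by simpa
  have hφφf : φ (φ f) ≠ 0 := by simpa
  simp only [projectivePoly, map_div₀, map_mul]
  field_simp
  linear_combination hf

theorem exists_projectivePoly_eq_zero_of_conj_argumentNormal [Finite K] [CharP K 2]
    {v : Fin 3 → K} (hv : v ≠ 0) {μ : K}
    (hμ : φ ∘ argumentNormal b v = μ • conjugateNormal a c v) :
    ∃ x, projectivePoly φ a b c x = 0 := by
  have h₀ : φ (v 2) = μ * (v 1 + c * v 2) := congrFun hμ 0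
  have h₁ : φ (v 0 + b * v 2) = μ * (a * v 2) := congrFun hμ 1
  have h₂ : φ (v 1) = μ * v 0 := congrFun hμ 2
  have hv2 : v 2 ≠ 0 := by
    intro hv2
    have hv0 : v 0 = 0 := by simpa [hv2] using h₁
    have hv1 : v 1 = 0 := by simpa [hv0] using h₂
    exact hv (by ext i; fin_cases i <;> assumption)
  have hφv2 : φ (v 2) ≠ 0 := by simpa
  set ν := μ * v 2 / φ (v 2) with hν
  have e₀ : ν * (v 1 / v 2 + c) = 1 := by
    rw [hν]; field_simp; linear_combination -h₀
  have e₁ : φ (v 0 / v 2) + φ b = ν * a := by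
    rw [map_add, map_mul] at h₁
    rw [hν, map_div₀]; field_simp; linear_combination h₁
  have e₂ : φ (v 1 / v 2) = ν * (v 0 / v 2) := by
    rw [hν, map_div₀]; field_simp; linear_combination h₂
  have e₀' : φ (φ ν) * (φ (φ (v 1 / v 2)) + φ (φ c)) = 1 := by
    simpa only [map_mul, map_add, map_one] using congrArg (fun t => φ (φ t)) e₀
  have e₂' : φ (φ (v 1 / v 2)) = φ ν * φ (v 0 / v 2) := by rw [e₂, map_mul]
  apply exists_projectivePoly_eq_zero_of_adjoint (μ := ν)
  linear_combination e₀' - φ (φ ν) * e₂' - φ (φ ν) * φ ν * e₁ +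
    (φ (φ ν) * φ ν * φ b + 1) * CharTwo.two_eq_zero (R := K)

theorem exists_projectivePoly_eq_zero_of_trivariateForm_self [Finite K] [CharP K 2] (ha : a ≠ 0)
    {u : Fin 3 → K} (hu : u ≠ 0) (hzero : trivariateForm a b c (φ ∘ u) u = 0) :
    ∃ x, projectivePoly φ a b c x = 0 := by
  obtain ⟨h₀, h₁, h₂⟩ : _ ∧ _ ∧ _ := ⟨congrFun hzero 0, congrFun hzero 1, congrFun hzero 2⟩
  simp only [trivariateForm_apply, Function.comp_apply, cons_val, Pi.zero_apply] at h₀ h₁ h₂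
  have hu1 : u 1 ≠ 0 := by
    intro hu1
    have hu2 : u 2 = 0 := by simpa [hu1] using h₂
    have hu0 : u 0 = 0 := by simpa [hu1, hu2] using h₀
    exact hu (by ext i; fin_cases i <;> assumption)
  have hu2 : u 2 ≠ 0 := by
    intro hu2
    have hu0 : u 0 = 0 := by simpa [hu1, hu2] using h₂
    exact hu1 (by simpa [hu0, hu2, ha] using h₁)
  obtain ⟨s, hs⟩ := Finite.surjective_of_injective φ.injective (u 1 / u 2)
  refine ⟨s, φ.injective ?_⟩
  have hφu1 : φ (u 1) ≠ 0 := by simpa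
  have hφu2 : φ (u 2) ≠ 0 := by simpa
  have hφφu2 : φ (φ (u 2)) ≠ 0 := by simpa
  have hφu0 : φ (u 0) = -(φ (u 2) * u 2) / u 1 := by
    field_simp
    linear_combination h₂
  have hφh₁ := congrArg φ h₁
  simp only [map_add, map_mul, map_zero, hφu0, map_div₀, map_neg] at hφh₁
  simp only [projectivePoly, map_add, map_mul, map_one, map_zero, hs, map_div₀]
  field_simp at hφh₁ ⊢
  linear_combination hφh₁ + (φ (φ (u 2)) * φ (u 2) * u 2 + φ (φ (u 2)) * φ (u 2) * u 1 * φ c) *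
    CharTwo.two_eq_zero (R := K)

theorem crossProduct_eq_zero_of_trivariateForm_add_eq_zero [Finite K] [CharP K 2] (ha : a ≠ 0)
    (hroot : ∀ x, projectivePoly φ a b c x ≠ 0) {u δ : Fin 3 → K} (hu : u ≠ 0)
    (h : trivariateForm a b c (φ ∘ δ) u + trivariateForm a b c (φ ∘ u) δ = 0) :
    u ⨯₃ δ = 0 := by
  set V := trivariateForm a b c (φ ∘ u) u
  have hV : V ≠ 0 := fun hzero =>
    (exists_projectivePoly_eq_zero_of_trivariateForm_self ha hu hzero).elim hroot
  have hswap : trivariateForm a b c (φ ∘ δ) u = trivariateForm a b c (φ ∘ u) δ := by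
    rwa [← sub_eq_zero, CharTwo.sub_eq_add]
  by_contra hind
  have argument_u : argumentNormal b V ⬝ᵥ u = 0 :=
    argumentNormal_trivariateForm_dotProduct_self _ _
  have argument_δ : argumentNormal b V ⬝ᵥ δ = 0 := by
    rw [argumentNormal_trivariateForm_dotProduct_comm, ← hswap,
      argumentNormal_trivariateForm_dotProduct_self]
  have conjugate_u : conjugateNormal a c V ⬝ᵥ (φ ∘ u) = 0 :=
    conjugateNormal_trivariateForm_dotProduct_self _ _
  have conjugate_δ : conjugateNormal a c V ⬝ᵥ (φ ∘ δ) = 0 := by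
    rw [conjugateNormal_trivariateForm_dotProduct_comm, hswap,
      conjugateNormal_trivariateForm_dotProduct_self]
  have hφind : (φ ∘ u) ⨯₃ (φ ∘ δ) ≠ 0 := by
    rw [← map_comp_crossProduct]
    exact fun h => hind (φ.injective.comp_left (h.trans (by ext; simp)))
  have hparallel : conjugateNormal a c V ⨯₃ (φ ∘ argumentNormal b V) = 0 :=
    crossProduct_eq_zero_of_dotProduct_eq_zero hφind conjugate_u conjugate_δ
      (by rw [← RingHom.map_dotProduct, argument_u, map_zero])
      (by rw [← RingHom.map_dotProduct, argument_δ, map_zero])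
  obtain ⟨μ, hμ⟩ := exists_smul_eq_of_crossProduct_eq_zero
    ((conjugateNormal_eq_zero_iff ha).not.mpr hV) hparallel
  exact (exists_projectivePoly_eq_zero_of_conj_argumentNormal hV hμ.symm).elim hroot

theorem trivariateForm_add_eq_zero_iff [Finite K] [CharP K 2] (ha : a ≠ 0)
    (hroot : ∀ x, projectivePoly φ a b c x ≠ 0) {u δ : Fin 3 → K} (hu : u ≠ 0) :
    trivariateForm a b c (φ ∘ δ) u + trivariateForm a b c (φ ∘ u) δ = 0 ↔
      ∃ t, φ t = t ∧ t • u = δ := by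
  have hV : trivariateForm a b c (φ ∘ u) u ≠ 0 := fun hzero =>
    (exists_projectivePoly_eq_zero_of_trivariateForm_self ha hu hzero).elim hroot
  have hsmul (t : K) : trivariateForm a b c (φ ∘ (t • u)) u +
      trivariateForm a b c (φ ∘ u) (t • u) = (φ t + t) • trivariateForm a b c (φ ∘ u) u := by
    have hφ : φ ∘ (t • u) = φ t • (φ ∘ u) := by ext; simp
    rw [hφ, map_smul, map_smul, LinearMap.smul_apply, add_smul]
  constructor
  · intro h
    obtain ⟨t, rfl⟩ := exists_smul_eq_of_crossProduct_eq_zero hu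
      (crossProduct_eq_zero_of_trivariateForm_add_eq_zero ha hroot hu h)
    rw [hsmul, smul_eq_zero_iff_left hV, CharTwo.add_eq_zero] at h
    exact ⟨t, h, rfl⟩
  · rintro ⟨t, ht, rfl⟩
    rw [hsmul, ht, CharTwo.add_self_eq_zero, zero_smul]

theorem polar_trivariateMap [CharP K 2] (k : ℕ) (x y : Fin 3 → K) :
    polar (trivariateMap (2 ^ k) a b c) x y =
      trivariateForm a b c (iterateFrobenius K 2 k ∘ x) y +
        trivariateForm a b c (iterateFrobenius K 2 k ∘ y) x := by
  rw [trivariateMap_eq_trivariateForm]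
  exact polar_bilinear_comp (trivariateForm a b c)
    ((iterateFrobenius K 2 k).compLeft (Fin 3)).toAddMonoidHom x y

theorem polar_trivariateMap_add_left [CharP K 2] (k : ℕ) (x x' y : Fin 3 → K) :
    polar (trivariateMap (2 ^ k) a b c) (x + x') y =
      polar (trivariateMap (2 ^ k) a b c) x y + polar (trivariateMap (2 ^ k) a b c) x' y := by
  rw [trivariateMap_eq_trivariateForm]
  exact polar_bilinear_comp_add_left (trivariateForm a b c)
    ((iterateFrobenius K 2 k).compLeft (Fin 3)).toAddMonoidHom x x' y

theorem projectivePoly_iterateFrobenius [CharP K 2] (k : ℕ) (x : K) :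
    projectivePoly (iterateFrobenius K 2 k) a b c x =
      a * x ^ ((2 ^ k) ^ 2 + 2 ^ k + 1) + b * x ^ (2 ^ k + 1) + c * x + 1 := by
  simp only [projectivePoly, iterateFrobenius_def]
  ring

theorem differentialUniformity_trivariateMap [Finite K] [CharP K 2] (ha : a ≠ 0) {k : ℕ}
    (hroot : ∀ x, projectivePoly (iterateFrobenius K 2 k) a b c x ≠ 0) :
    differentialUniformity (trivariateMap (2 ^ k) a b c) = {t : K | t ^ 2 ^ k = t}.ncard := by
  refine differentialUniformity_eq_of_ncard_polar (polar_trivariateMap_add_left k) fun u hu => ?_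
  rw [← Set.ncard_image_of_injective {t : K | t ^ 2 ^ k = t} (smul_left_injective K hu)]
  congr 1
  ext δ
  simp only [Set.mem_ofPred_eq, polar_trivariateMap, trivariateForm_add_eq_zero_iff ha hroot hu,
    iterateFrobenius_def, Set.mem_image]

end Trivariate

theorem theorem1p3 {K : Type*} [Field K] [Finite K] (m k d σ : ℕ)
    (hK : Nat.card K = 2 ^ m) (hk : 1 ≤ k) (hkm : k < m)
    (hd : d = Nat.gcd k m) (hσ : σ = 2 ^ k)
    (a b c : K) (ha : a ≠ 0)
    (hroot : ∀ x : K, a * x ^ (σ ^ 2 + σ + 1) + b * x ^ (σ + 1) + c * x + 1 ≠ 0) :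
    IsSemiquadratic σ (trivariateMap σ a b c) ∧
      differentialUniformity (trivariateMap σ a b c) = 2 ^ d ∧
      (d = 1 → IsAPN (trivariateMap σ a b c)) := by
  have : CharP K 2 := by
    have := Fintype.ofFinite K
    exact charP_of_card_eq_prime_pow (Nat.card_eq_fintype_card.symm.trans hK)
  subst hσ hd
  have huniformity : differentialUniformity (trivariateMap (2 ^ k) a b c) = 2 ^ k.gcd m := by
    rw [differentialUniformity_trivariateMap ha (by simpa only [projectivePoly_iterateFrobenius]),
      ncard_pow_pow_eq_self two_ne_zero hK]
  refine ⟨?_, huniformity, fun h => by rw [IsAPN, huniformity, h, pow_one]⟩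
  rw [trivariateMap_eq_trivariateForm]
  exact isSemiquadratic_of_bilinear _ _
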